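/- Let $S^1=\mathbb R/\mathbb Z$ be the circle of length $1$ with its arc-length distance, let $\delta\in(0,1)$, and let $\alpha\in(0,1)$ be irrational of Diophantine class $\nu=1$, i.e. the inequality $\|q\alpha\|<q^{-\mu}$ (where $\|\cdot\|$ is the distance to the nearest integer) has infinitely many solutions in positive integers $q$ for every real $\mu<1$ and only finitely many for every $\mu>1$. Let $f\colon S^1\to S^1$ be an orientation-preserving homeomorphism (for instance, a $\mathcal C^{1+\delta}$ diffeomorphism) with a semi-conjugacy $h\colon S^1\to S^1$ to the rotation $R_\alpha(t)=t+\alpha$, that is, $h$ is continuous, monotone of degree one, and $h\circ f=R_\alpha\circ h$. For $n\in\mathbb Z$ let $J_n$ be the interior of $h^{-1}(\{n\alpha\})$, an open arc, and let $|J_n|$ be its length. Assume that $f$ is a Denjoy map whose gap lengths form a Denjoy sequence of class $\delta$, i.e. \[ \sum_{n\in\mathbb Z}|J_n|=1,\qquad \liminf_{n\to\pm\infty}\frac{\ln\bigl||J_n|-|J_{n+1}|\bigr|}{\ln|J_n|}=1+\delta \] (the liminf being taken as $|n|\to\infty$, with $\ln 0=-\infty$), and let $\Omega=S^1\setminus\bigcup_{n\in\mathbb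 Z}J_n$ be the minimal set of $f$. Suppose that for every $\varepsilon>0$ there are a strictly increasing sequence $(n_s)$ of positive integers and a constant $C<\infty$ such that \[ \sum_{|k|>n_s}|J_k|\le C\,n_s^{\,1-\frac1{\delta+\varepsilon}}\qquad\text{for all } s. \] Then $\dim_H(\Omega)=\delta$. -/

import Mathlib

open Set Filter MeasureTheory

/-- The circle `ℝ / ℤ` of length `1` is `UnitAddCircle`; its metric is the arc-length distance and
its `volume` is arc length.  A self-map of the circle is *monotone of degree one* if it has a
continuous monotone lift `G : ℝ → ℝ` with `G (x + 1) = G x + 1`. A homeomorphism of the circle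
has this property exactly when it preserves orientation. -/
def IsMonotoneDegreeOne (g : UnitAddCircle → UnitAddCircle) : Prop :=
  ∃ G : CircleDeg1Lift, Continuous G ∧
    ∀ x : ℝ, g (x : UnitAddCircle) = ((G x : ℝ) : UnitAddCircle)

/-- `h` is a (Poincaré) semi-conjugacy from the circle homeomorphism `f` to the rotation
`R_α : t ↦ t + α`: a continuous monotone degree one map with `h ∘ f = R_α ∘ h`. -/
structure IsRotationSemiconj (α : ℝ) (f : UnitAddCircle ≃ₜ UnitAddCircle)
    (h : UnitAddCircle → UnitAddCircle) : Prop where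
  monotone_degree_one : IsMonotoneDegreeOne h
  semiconj : ∀ x, h (f x) = h x + (α : UnitAddCircle)

/-- The gap `J_n`: the open arc that `h` collapses to the point `n α` of the orbit of `0`
(the interior of the closed arc `h ⁻¹ {n α}`). -/
def denjoyGap (α : ℝ) (h : UnitAddCircle → UnitAddCircle) (n : ℤ) : Set UnitAddCircle :=
  interior (h ⁻¹' {(((n : ℝ) * α : ℝ) : UnitAddCircle)})

/-- The length `|J_n|` of the gap `J_n`. -/
noncomputable def denjoyGapLength (α : ℝ) (h : UnitAddCircle → UnitAddCircle) (n : ℤ) : ℝ :=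
  (volume : Measure UnitAddCircle).real (denjoyGap α h n)

/-- The minimal set `Ω = S¹ \ ⋃ₙ J_n`. -/
def denjoyMinimalSet (α : ℝ) (h : UnitAddCircle → UnitAddCircle) : Set UnitAddCircle :=
  (⋃ n : ℤ, denjoyGap α h n)ᶜ

/-- Denjoy sequences of class `δ`. The logarithms take values in `[-∞, ∞]`, so that `ln 0 = -∞`
and the quotient is `+∞` at an index with `ℓ n = ℓ (n + 1) ∈ (0, 1)`. -/
structure IsDenjoySequence (δ : ℝ) (l : ℤ → ℝ) : Prop where
  nonneg : ∀ n, 0 ≤ l n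
  hasSum : HasSum l 1
  liminf_eq : liminf (fun n : ℤ =>
      ENNReal.log (ENNReal.ofReal |l n - l (n + 1)|) / ENNReal.log (ENNReal.ofReal (l n)))
    (atBot ⊔ atTop) = ((1 + δ : ℝ) : EReal)

/-- The real number `α` is of Diophantine class `ν ∈ [1, ∞]`: the inequality `‖q α‖ < 1 / q ^ μ`,
where `‖·‖` is the distance to the nearest integer, has infinitely many solutions in positive
integers `q` for every real `μ < ν` and only finitely many for every real `μ > ν`. -/
structure IsDiophantineClass (α : ℝ) (ν : EReal) : Prop where
  one_le : 1 ≤ ν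
  infinite_of_lt : ∀ μ : ℝ, (μ : EReal) < ν →
    {q : ℕ | 0 < q ∧ ‖(((q : ℝ) * α : ℝ) : UnitAddCircle)‖ < 1 / (q : ℝ) ^ μ}.Infinite
  finite_of_gt : ∀ μ : ℝ, ν < (μ : EReal) →
    {q : ℕ | 0 < q ∧ ‖(((q : ℝ) * α : ℝ) : UnitAddCircle)‖ < 1 / (q : ℝ) ^ μ}.Finite

/-! ### The circle and its covering line -/

/-! Lower bound: `h` is Hölder of every exponent `r < δ`
(`exists_holderOnWith_of_isDenjoySequence`), while `h(Ω)` misses at most the countable orbit of `0`,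
so `1 ≤ dim h(Ω) ≤ dim Ω / r`. The Hölder estimate combines two facts. Diophantine class 1 puts one
of the first `O(t ^ (-μ))` orbit points in any image arc of length `t`, so the source arc contains
the corresponding gap. The liminf condition makes `|J_n| ^ (-d)` grow at most linearly for `d < δ`,
so that gap, and hence the source arc, is not too short.

Upper bound: deleting the gaps with `|k| ≤ n` leaves `2n + 2` arcs whose total length is at most the
tail sum. By the power mean inequality their `d`-th powers sum to at most `(2n + 2) ^ (1 - d) * (C *
n ^ (1 - 1 / d)) ^ d`, which is bounded, so the `d`-dimensional Hausdorff measure of `Ω` is finite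
for every `d` in `(δ, 1)`. -/

theorem UnitAddCircle.coe_eq_coe_iff {x y : ℝ} :
    (x : UnitAddCircle) = (y : UnitAddCircle) ↔ ∃ m : ℤ, y = x + m := by
  rw [QuotientAddGroup.eq, AddSubgroup.mem_zmultiples_iff]
  refine exists_congr fun m => ?_
  simp only [zsmul_eq_mul, mul_one]
  constructor <;> intro h <;> linarith

theorem UnitAddCircle.norm_coe_le (x : ℝ) : ‖(x : UnitAddCircle)‖ ≤ |x| := by
  rw [UnitAddCircle.norm_eq]
  simpa using round_le x 0

theorem UnitAddCircle.lipschitzWith_coe : LipschitzWith 1 ((↑) : ℝ → UnitAddCircle) :=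
  LipschitzWith.of_dist_le_mul fun x y => by
    have := UnitAddCircle.norm_coe_le (x - y)
    rw [AddCircle.coe_sub] at this
    simpa [dist_eq_norm] using this

/-- Two points of the circle have lifts at the same distance. -/
theorem UnitAddCircle.exists_lift_dist (X Y : UnitAddCircle) :
    ∃ x y : ℝ, (x : UnitAddCircle) = X ∧ (y : UnitAddCircle) = Y ∧ |x - y| = dist X Y := by
  induction X using QuotientAddGroup.induction_on with
  | H x =>
  induction Y using QuotientAddGroup.induction_on with
  | H y =>
  refine ⟨x - round (x - y), y, ?_, rfl, ?_⟩
  · exact UnitAddCircle.coe_eq_coe_iff.2 ⟨round (x - y), by ring⟩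
  · have : dist (x : UnitAddCircle) (y : UnitAddCircle) = ‖((x - y : ℝ) : UnitAddCircle)‖ := by
      rw [dist_eq_norm, AddCircle.coe_sub]
    rw [show ((QuotientAddGroup.mk x : UnitAddCircle)) = (x : UnitAddCircle) from rfl,
      show ((QuotientAddGroup.mk y : UnitAddCircle)) = (y : UnitAddCircle) from rfl, this,
      UnitAddCircle.norm_eq]
    congr 1
    ring

theorem UnitAddCircle.volume_image_coe_Icc_le (x y : ℝ) :
    volume (((↑) : ℝ → UnitAddCircle) '' Icc x y) ≤ ENNReal.ofReal (y - x) := by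
  rcases le_or_gt 1 (y - x) with h1 | h1
  · calc volume (((↑) : ℝ → UnitAddCircle) '' Icc x y) ≤ volume (univ : Set UnitAddCircle) :=
          measure_mono (subset_univ _)
      _ = ENNReal.ofReal 1 := by rw [UnitAddCircle.measure_univ, ENNReal.ofReal_one]
      _ ≤ _ := ENNReal.ofReal_le_ofReal h1
  · have hmeas : MeasurableSet (((↑) : ℝ → UnitAddCircle) '' Icc x y) :=
      (isCompact_Icc.image UnitAddCircle.lipschitzWith_coe.continuous).isClosed.measurableSet
    -- The fundamental domain `(y - 1, y]` is chosen so that only the translate `m = 0` of `[x, y]`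
    -- meets it.
    have hmp := UnitAddCircle.measurePreserving_mk (y - 1)
    rw [← hmp.measure_preimage hmeas.nullMeasurableSet,
      Measure.restrict_apply (hmp.measurable hmeas), ← Real.volume_Icc]
    refine measure_mono ?_
    rintro z ⟨⟨w, hw, hwz⟩, hz⟩
    obtain ⟨m, hm⟩ := UnitAddCircle.coe_eq_coe_iff.1 hwz
    have h2 : (-1 : ℝ) < m := by linarith [hz.1, hw.2]
    have h3 : (m : ℝ) < 1 := by linarith [hz.2, hw.1]
    have h4 : m = 0 := by
      have : -1 < m := by exact_mod_cast h2
      have : m < 1 := by exact_mod_cast h3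
      omega
    rw [h4, Int.cast_zero, add_zero] at hm
    exact hm ▸ hw

theorem UnitAddCircle.one_le_dimH_univ : 1 ≤ dimH (univ : Set UnitAddCircle) := by
  have hiso : Isometry fun x : Icc (0 : ℝ) (1 / 2) => ((x : ℝ) : UnitAddCircle) := by
    refine Isometry.of_dist_eq fun x y => ?_
    have h1 := x.2.1
    have h2 := x.2.2
    have h3 := y.2.1
    have h4 := y.2.2
    rw [dist_eq_norm, ← AddCircle.coe_sub, (AddCircle.norm_coe_eq_abs_iff 1 one_ne_zero).2,
      Subtype.dist_eq, Real.dist_eq]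
    rw [abs_one, abs_le]
    constructor <;> linarith
  have h1 : dimH (Icc (0 : ℝ) (1 / 2)) = 1 := by
    have := Real.dimH_of_nonempty_interior (E := ℝ) (s := Icc (0 : ℝ) (1 / 2)) (by
      rw [interior_Icc]; exact ⟨1 / 4, by norm_num, by norm_num⟩)
    simpa using this
  have h2 := (isometry_subtype_coe (s := Icc (0 : ℝ) (1 / 2))).dimH_image univ
  rw [image_univ, Subtype.range_coe, h1] at h2
  rw [h2, ← hiso.dimH_image univ]
  exact dimH_mono (subset_univ _)

/-! ### Diophantine approximation -/

/-- If `p / q` is a reduced fraction, `q ≤ n` and `|α - p / q| ≤ 1 / ((n + 1) q)`, the first `q`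
points of the orbit of `0` under the rotation by `α` meet every interval longer than `3 / q`. -/
theorem exists_mul_add_mem_Ioo_of_abs_sub_le {α : ℝ} {r : ℚ} {n : ℕ} (hn : r.den ≤ n)
    (hr : |α - r| ≤ 1 / (((n : ℝ) + 1) * r.den)) {a b : ℝ} (hab : 3 / (r.den : ℝ) < b - a) :
    ∃ j : ℕ, j < r.den ∧ ∃ m : ℤ, (j : ℝ) * α + m ∈ Ioo a b := by
  have hq : 0 < r.den := r.den_pos
  have hqR : (0 : ℝ) < r.den := by exact_mod_cast hq
  have hcop : IsCoprime r.num (r.den : ℤ) := by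
    rw [Int.isCoprime_iff_gcd_eq_one, Int.gcd, Int.natAbs_natCast]
    exact r.reduced
  obtain ⟨u, v, huv⟩ := hcop
  set i : ℤ := round ((r.den : ℝ) * ((a + b) / 2)) with hi
  -- `u` inverts the numerator modulo `q = r.den`, so `J * r` equals `i / q` modulo 1. Rounding
  -- costs `1 / (2q)` and replacing `r` by `α` costs at most `1 / q`: together half of `3 / q`.
  set J : ℤ := (i * u) % r.den with hJ
  have hJ0 : 0 ≤ J := Int.emod_nonneg _ (by exact_mod_cast hq.ne')
  have hJq : J < r.den := Int.emod_lt_of_pos _ (by exact_mod_cast hq)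
  obtain ⟨m, hm⟩ : ∃ m : ℤ, i = J * r.num + m * r.den := by
    refine ⟨i * v + (i * u / r.den) * r.num, ?_⟩
    have h1 : J = i * u - r.den * (i * u / r.den) := Int.emod_def _ _
    rw [h1]
    linear_combination (-i) * huv
  have hjJ : ((J.toNat : ℕ) : ℝ) = (J : ℝ) := by exact_mod_cast Int.toNat_of_nonneg hJ0
  refine ⟨J.toNat, by omega, m, ?_⟩
  rw [hjJ]
  have hJ0R : (0 : ℝ) ≤ J := by exact_mod_cast hJ0
  have hJqR : (J : ℝ) ≤ r.den := by exact_mod_cast hJq.le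
  have hround : |(r.den : ℝ) * ((a + b) / 2) - i| ≤ 1 / 2 := abs_sub_round _
  have hrr : (r : ℝ) * r.den = r.num := by exact_mod_cast Rat.mul_den_eq_num r
  have hmR : (i : ℝ) = J * r.num + m * r.den := by exact_mod_cast hm
  have hJr : |(J : ℝ) * (α - r)| * r.den ≤ 1 := by
    rw [abs_mul, abs_of_nonneg hJ0R]
    have hnR : (r.den : ℝ) ≤ n + 1 := by exact_mod_cast hn.trans (Nat.le_succ n)
    calc (J : ℝ) * |α - r| * r.den ≤ r.den * (1 / (((n : ℝ) + 1) * r.den)) * r.den := by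
          gcongr
      _ = r.den / (n + 1) := by field_simp
      _ ≤ 1 := by rw [div_le_one (by positivity)]; exact hnR
  have key : ((J : ℝ) * α + m - (a + b) / 2) * r.den
      = (J * (α - r)) * r.den + (i - r.den * ((a + b) / 2)) := by
    rw [hmR, ← hrr]; ring
  have hlen : 3 < (b - a) * r.den := by rwa [div_lt_iff₀ hqR] at hab
  have h1 := abs_le.1 hround
  have h2 : |(J * (α - r)) * r.den| ≤ 1 := by rwa [abs_mul, abs_of_pos hqR]
  have h3 := abs_le.1 h2
  constructor
  · refine lt_of_mul_lt_mul_right (a := (r.den : ℝ)) ?_ hqR.le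
    nlinarith
  · refine lt_of_mul_lt_mul_right (a := (r.den : ℝ)) ?_ hqR.le
    nlinarith

/-- The finitely many exceptional `q` are absorbed into `M`, as irrationality keeps each `‖q α‖`
positive. -/
theorem IsDiophantineClass.exists_one_le_mul_norm {α μ : ℝ} (hα : Irrational α)
    (hν : IsDiophantineClass α 1) (hμ : 1 < μ) :
    ∃ M : ℝ, 1 ≤ M ∧ ∀ q : ℕ, 0 < q →
      1 ≤ M * (q : ℝ) ^ μ * ‖(((q : ℝ) * α : ℝ) : UnitAddCircle)‖ := by
  have hpos : ∀ q : ℕ, 0 < q → 0 < ‖(((q : ℝ) * α : ℝ) : UnitAddCircle)‖ := by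
    intro q hq
    rw [UnitAddCircle.norm_eq, abs_pos, sub_ne_zero]
    exact (hα.natCast_mul hq.ne').ne_int _
  have hfin := hν.finite_of_gt μ (by exact_mod_cast hμ)
  obtain ⟨B, hB⟩ := (hfin.image fun q : ℕ =>
    1 / ((q : ℝ) ^ μ * ‖(((q : ℝ) * α : ℝ) : UnitAddCircle)‖)).bddAbove
  refine ⟨max B 1, le_max_right _ _, fun q hq => ?_⟩
  have hqμ : 0 < (q : ℝ) ^ μ := Real.rpow_pos_of_pos (by exact_mod_cast hq) _
  have hprod := mul_pos hqμ (hpos q hq)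
  rw [mul_assoc, ← div_le_iff₀ hprod]
  by_cases hlt : ‖(((q : ℝ) * α : ℝ) : UnitAddCircle)‖ < 1 / (q : ℝ) ^ μ
  · exact (hB ⟨q, ⟨hq, hlt⟩, rfl⟩).trans (le_max_left _ _)
  · refine le_trans ?_ (le_max_right _ _)
    rw [div_le_one hprod]
    rw [not_lt, div_le_iff₀ hqμ] at hlt
    linarith

/-- For `α` of Diophantine class `1` and `μ > 1`, the first `O(t ^ (-μ))` points of the orbit of
`0` under the rotation by `α` meet every interval of length `t ≤ 1`. -/
theorem IsDiophantineClass.exists_mul_add_mem_Ioo {α μ : ℝ} (hα : Irrational α)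
    (hν : IsDiophantineClass α 1) (hμ : 1 < μ) :
    ∃ K : ℝ, 0 < K ∧ ∀ a b : ℝ, a < b → b - a ≤ 1 →
      ∃ j : ℕ, ((j : ℝ) + 1) * (b - a) ^ μ ≤ K ∧ ∃ m : ℤ, (j : ℝ) * α + m ∈ Ioo a b := by
  obtain ⟨M, hM1, hM⟩ := hν.exists_one_le_mul_norm hα hμ
  refine ⟨2 * M * 3 ^ μ, by positivity, fun a b hab hab1 => ?_⟩
  set t := b - a with ht
  have ht0 : 0 < t := sub_pos.2 hab
  -- Dirichlet's `‖q α‖ ≤ 1 / (Q + 1)` against the Diophantine lower bound gives `M * q ^ μ ≥ Q +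
  -- 1`; this `Q` then forces `q > 3 / t`.
  set Q : ℕ := ⌈M * (3 / t) ^ μ⌉₊ with hQ
  have h3t : 1 ≤ (3 / t) ^ μ :=
    Real.one_le_rpow (by rw [le_div_iff₀ ht0]; linarith) (by linarith)
  have hMt : 1 ≤ M * (3 / t) ^ μ := by nlinarith
  have hQ0 : 0 < Q := Nat.ceil_pos.2 (by linarith)
  have hQle : (Q : ℝ) ≤ 2 * (M * (3 / t) ^ μ) := by
    have := (Nat.ceil_lt_add_one (show 0 ≤ M * (3 / t) ^ μ by linarith)).le
    linarith
  obtain ⟨r, hr, hrQ⟩ := Real.exists_rat_abs_sub_le_and_den_le α hQ0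
  have hqR : (0 : ℝ) < r.den := by exact_mod_cast r.den_pos
  have hnorm : ‖(((r.den : ℝ) * α : ℝ) : UnitAddCircle)‖ ≤ 1 / ((Q : ℝ) + 1) := by
    have h1 : (((r.den : ℝ) * α : ℝ) : UnitAddCircle) = (((r.den : ℝ) * (α - r) : ℝ)) := by
      refine UnitAddCircle.coe_eq_coe_iff.2 ⟨-r.num, ?_⟩
      have : (r : ℝ) * r.den = r.num := by exact_mod_cast Rat.mul_den_eq_num r
      push_cast
      rw [← this]; ring
    rw [h1]
    refine (UnitAddCircle.norm_coe_le _).trans ?_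
    rw [abs_mul, abs_of_pos hqR]
    calc (r.den : ℝ) * |α - r| ≤ r.den * (1 / (((Q : ℝ) + 1) * r.den)) := by gcongr
      _ = 1 / ((Q : ℝ) + 1) := by field_simp
  have hqlarge : 3 / (r.den : ℝ) < t := by
    have hMq := hM r.den r.den_pos
    have hqμ : 0 < (r.den : ℝ) ^ μ := Real.rpow_pos_of_pos hqR _
    have h1 : 1 ≤ M * (r.den : ℝ) ^ μ * (1 / ((Q : ℝ) + 1)) :=
      hMq.trans (by gcongr)
    rw [mul_one_div, one_le_div (by positivity)] at h1
    have h2 : M * (3 / t) ^ μ ≤ Q := Nat.le_ceil _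
    have h3 : (3 / t) ^ μ < (r.den : ℝ) ^ μ := by
      by_contra! hcon
      nlinarith
    have h4 : 3 / t < r.den := (Real.rpow_lt_rpow_iff (by positivity) hqR.le (by linarith)).1 h3
    rw [div_lt_iff₀ ht0] at h4
    rw [div_lt_iff₀ hqR]
    linarith
  obtain ⟨j, hj, hm⟩ := exists_mul_add_mem_Ioo_of_abs_sub_le hrQ hr hqlarge
  refine ⟨j, ?_, hm⟩
  have hjQ : (j : ℝ) + 1 ≤ Q := by exact_mod_cast (Nat.succ_le_of_lt hj).trans hrQ
  calc ((j : ℝ) + 1) * t ^ μ ≤ 2 * (M * (3 / t) ^ μ) * t ^ μ := by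
        gcongr; exact hjQ.trans hQle
    _ = 2 * M * 3 ^ μ := by
        rw [Real.div_rpow (by norm_num) ht0.le]
        have : 0 < t ^ μ := Real.rpow_pos_of_pos ht0 _
        field_simp

/-! ### Decay of Denjoy sequences -/

/-- The substitution `x ↦ x ^ (-d)` linearises the recursion: with `s = x ^ d`, `(1 - s) ^ (-d) ≤ 1
+ 2 * s`, and multiplying by `s⁻¹` adds just the constant `2`. -/
theorem rpow_neg_le_add_two {d x y : ℝ} (hd0 : 0 < d) (hd1 : d ≤ 1) (hx : 0 < x)
    (hxd : x ^ d ≤ 1 / 2) (hxy : x - x ^ (1 + d) ≤ y) : y ^ (-d) ≤ x ^ (-d) + 2 := by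
  set s := x ^ d with hs
  have hs0 : 0 < s := Real.rpow_pos_of_pos hx d
  have h1 : x * (1 - s) ≤ y := by
    rw [Real.rpow_add hx, Real.rpow_one] at hxy
    linarith
  have h2 : 0 < 1 - s := by linarith
  have h3 : y ^ (-d) ≤ (x * (1 - s)) ^ (-d) :=
    Real.rpow_le_rpow_of_nonpos (mul_pos hx h2) h1 (by linarith)
  rw [Real.mul_rpow hx.le h2.le, Real.rpow_neg hx.le, ← hs] at h3
  have h4 : (1 - s) ^ (-d) ≤ (1 - s)⁻¹ := by
    rw [← Real.rpow_neg_one]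
    exact Real.rpow_le_rpow_of_exponent_ge h2 (by linarith) (by linarith)
  have h5 : (1 - s)⁻¹ ≤ 1 + 2 * s := by
    rw [inv_le_comm₀ h2 (by linarith), inv_le_comm₀ (by linarith) h2, inv_le_iff_one_le_mul₀ h2]
    nlinarith
  rw [Real.rpow_neg hx.le, ← hs]
  calc y ^ (-d) ≤ s⁻¹ * (1 - s) ^ (-d) := h3
    _ ≤ s⁻¹ * (1 + 2 * s) := by gcongr; exact h4.trans h5
    _ = s⁻¹ + 2 := by field_simp

theorem IsDenjoySequence.eventually_pos_and_sub_le {δ d : ℝ} {l : ℤ → ℝ}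
    (hl : IsDenjoySequence δ l) (hd0 : 0 < d) (hd : d < δ) :
    ∀ᶠ n : ℤ in atTop, 0 < l n ∧ l n ^ d ≤ 1 / 2 ∧ l n - l n ^ (1 + d) ≤ l (n + 1) := by
  have hlim : Tendsto l atTop (nhds 0) :=
    hl.hasSum.summable.tendsto_cofinite_zero.mono_left
      (by rw [Int.cofinite_eq]; exact le_sup_right)
  have hlimd : Tendsto (fun n => l n ^ d) atTop (nhds 0) := by
    have := hlim.rpow_const (p := d) (Or.inr hd0.le)
    rwa [Real.zero_rpow hd0.ne'] at this
  have hev : ∀ᶠ n : ℤ in atTop, ((1 + d : ℝ) : EReal) <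
      ENNReal.log (ENNReal.ofReal |l n - l (n + 1)|) / ENNReal.log (ENNReal.ofReal (l n)) := by
    refine Eventually.filter_mono (le_sup_right (a := atBot)) (eventually_lt_of_lt_liminf ?_)
    rw [hl.liminf_eq]
    exact_mod_cast (by linarith : 1 + d < 1 + δ)
  filter_upwards [hev, hlim.eventually_lt_const one_pos,
    hlimd.eventually_le_const (show (0 : ℝ) < 1 / 2 by norm_num)] with n h1 h2 h3
  have hpos : 0 < l n := by
    -- At `l n = 0` the denominator is `⊥`, and division by `⊥` gives `0`, below `1 + d`.
    refine (hl.nonneg n).lt_of_ne' fun h0 => ?_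
    rw [h0, ENNReal.ofReal_zero, ENNReal.log_zero, EReal.div_bot] at h1
    have : (1 + d : ℝ) < 0 := by exact_mod_cast h1
    linarith
  refine ⟨hpos, h3, ?_⟩
  have hpow : 0 < l n ^ (1 + d) := Real.rpow_pos_of_pos hpos _
  rcases eq_or_ne (l n) (l (n + 1)) with heq | hne
  · linarith
  have habs : 0 < |l n - l (n + 1)| := abs_pos.2 (sub_ne_zero.2 hne)
  have hlog : Real.log (l n) < 0 := Real.log_neg hpos h2
  rw [ENNReal.log_ofReal_of_pos habs, ENNReal.log_ofReal_of_pos hpos, ← EReal.coe_div,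
    EReal.coe_lt_coe_iff, lt_div_iff_of_neg hlog, ← Real.log_rpow hpos,
    Real.log_lt_log_iff habs hpow] at h1
  linarith [le_abs_self (l n - l (n + 1))]

/-- The terms of a Denjoy sequence of class `δ` decay at most like `n ^ (-1 / d)`, for `d < δ`. -/
theorem IsDenjoySequence.exists_rpow_lower_bound {δ d : ℝ} {l : ℤ → ℝ}
    (hl : IsDenjoySequence δ l) (hd0 : 0 < d) (hd : d < δ) (hd1 : d ≤ 1) :
    ∃ (N : ℤ) (A : ℝ), 0 < A ∧ ∀ j : ℕ, 0 < l (N + j) ∧ 1 ≤ A * ((j : ℝ) + 1) * l (N + j) ^ d := by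
  obtain ⟨N, hN⟩ := eventually_atTop.1 (hl.eventually_pos_and_sub_le hd0 hd)
  have hNj : ∀ j : ℕ, _ := fun j => hN (N + j) (by omega)
  have hind : ∀ j : ℕ, l (N + j) ^ (-d) ≤ l N ^ (-d) + 2 * j := by
    intro j
    induction j with
    | zero => simp
    | succ j ih =>
      obtain ⟨h1, h2, h3⟩ := hNj j
      have := rpow_neg_le_add_two hd0 hd1 h1 h2 h3
      push_cast
      rw [← add_assoc]
      linarith
  have hA : 0 < l N ^ (-d) := Real.rpow_pos_of_pos (by simpa using (hNj 0).1) _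
  refine ⟨N, l N ^ (-d) + 2, by linarith, fun j => ⟨(hNj j).1, ?_⟩⟩
  have hlj : 0 < l (N + j) ^ d := Real.rpow_pos_of_pos (hNj j).1 _
  have hj : (0 : ℝ) ≤ j := Nat.cast_nonneg j
  have h1 := hind j
  rw [Real.rpow_neg (hNj j).1.le, inv_le_iff_one_le_mul₀ hlj] at h1
  refine h1.trans (mul_le_mul_of_nonneg_right ?_ hlj.le)
  nlinarith

/-! ### Lifts of the semi-conjugacy -/

section Lift

variable {α : ℝ} {h : UnitAddCircle → UnitAddCircle} {G : CircleDeg1Lift}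

theorem CircleDeg1Lift.surjective_of_continuous (G : CircleDeg1Lift) (hGc : Continuous G) :
    Function.Surjective G :=
  G.continuous_iff_surjective.1 hGc

theorem CircleDeg1Lift.exists_eq_iff_mem_Icc (G : CircleDeg1Lift) (hGc : Continuous G) (c : ℝ) :
    ∃ u v : ℝ, u ≤ v ∧ ∀ w, G w = c ↔ w ∈ Icc u v := by
  obtain ⟨w₀, hw₀⟩ := G.surjective_of_continuous hGc c
  have hclosed : IsClosed (G ⁻¹' {c}) := isClosed_singleton.preimage hGc
  have hsub : G ⁻¹' {c} ⊆ Icc (w₀ - 1) (w₀ + 1) := by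
    intro w hw
    have hw : G w = c := hw
    constructor
    · by_contra! hlt
      have h1 := G.monotone (show w + 1 ≤ w₀ by linarith)
      rw [G.map_add_one] at h1
      linarith
    · by_contra! hlt
      have h1 := G.monotone hlt.le
      rw [G.map_add_one] at h1
      linarith
  have hcpt : IsCompact (G ⁻¹' {c}) := isCompact_Icc.of_isClosed_subset hclosed hsub
  have hconn : IsConnected (G ⁻¹' {c}) :=
    ⟨⟨w₀, hw₀⟩, (ordConnected_singleton.preimage_mono G.monotone).isPreconnected⟩
  have hIcc := eq_Icc_of_connected_compact hconn hcpt
  have hmem : w₀ ∈ Icc (sInf (G ⁻¹' {c})) (sSup (G ⁻¹' {c})) := hIcc ▸ hw₀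
  exact ⟨_, _, hmem.1.trans hmem.2, fun w => Set.ext_iff.1 hIcc w⟩

theorem denjoyGap_subset_preimage {n : ℤ} :
    denjoyGap α h n ⊆ h ⁻¹' {(((n : ℝ) * α : ℝ) : UnitAddCircle)} :=
  interior_subset

/-- The sheet `m` can be prescribed because `G` commutes with integer translations. -/
theorem exists_lift_of_mem_denjoyGap (hG : ∀ x : ℝ, h x = ((G x : ℝ) : UnitAddCircle))
    {n : ℤ} {m : ℤ} {z : UnitAddCircle} (hz : z ∈ denjoyGap α h n) :
    ∃ w : ℝ, (w : UnitAddCircle) = z ∧ G w = n * α + m := by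
  have hz' : h z = ((n * α : ℝ) : UnitAddCircle) := denjoyGap_subset_preimage hz
  induction z using QuotientAddGroup.induction_on with
  | H x =>
  rw [hG, eq_comm, UnitAddCircle.coe_eq_coe_iff] at hz'
  obtain ⟨k, hk⟩ := hz'
  refine ⟨x + ((m - k : ℤ) : ℝ), ?_, ?_⟩
  · exact (UnitAddCircle.coe_eq_coe_iff.2 ⟨m - k, rfl⟩).symm
  · rw [G.map_add_int, hk]
    push_cast
    ring

theorem denjoyGapLength_le_of_forall_mem_Icc (hG : ∀ x : ℝ, h x = ((G x : ℝ) : UnitAddCircle))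
    {n m : ℤ} {u v : ℝ} (huv : u ≤ v) (hw : ∀ w, G w = n * α + m → w ∈ Icc u v) :
    denjoyGapLength α h n ≤ v - u := by
  refine ENNReal.toReal_le_of_le_ofReal (sub_nonneg.2 huv)
    (le_trans (measure_mono fun z hz => ?_) (UnitAddCircle.volume_image_coe_Icc_le u v))
  obtain ⟨w, hwz, hwc⟩ := exists_lift_of_mem_denjoyGap (m := m) hG hz
  exact ⟨w, hw w hwc, hwz⟩

theorem image_coe_Ioo_subset_denjoyGap (hG : ∀ x : ℝ, h x = ((G x : ℝ) : UnitAddCircle))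
    {n m : ℤ} {u v : ℝ} (hw : ∀ w ∈ Ioo u v, G w = n * α + m) :
    ((↑) : ℝ → UnitAddCircle) '' Ioo u v ⊆ denjoyGap α h n := by
  refine interior_maximal ?_ (QuotientAddGroup.isOpenMap_coe _ isOpen_Ioo)
  rintro _ ⟨w, hwI, rfl⟩
  rw [mem_preimage, hG, hw w hwI, mem_singleton_iff, eq_comm, UnitAddCircle.coe_eq_coe_iff]
  exact ⟨m, rfl⟩

/-! ### The lower bound -/

theorem exists_holderOnWith_of_isDenjoySequence {δ d μ : ℝ} (hα : Irrational α)
    (hν : IsDiophantineClass α 1) (hG : ∀ x : ℝ, h x = ((G x : ℝ) : UnitAddCircle))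
    (hJ : IsDenjoySequence δ (denjoyGapLength α h)) (hd0 : 0 < d) (hd : d < δ) (hd1 : d ≤ 1)
    (hμ : 1 < μ) :
    ∃ C : NNReal, ∀ s, HolderOnWith C (d / μ).toNNReal h s := by
  obtain ⟨K, hK0, hK⟩ := hν.exists_mul_add_mem_Ioo hα hμ
  obtain ⟨N, A, hA0, hA⟩ := hJ.exists_rpow_lower_bound hd0 hd hd1
  have hμ0 : 0 < μ := by linarith
  have key : ∀ x y : ℝ, x ≤ y → y - x ≤ 1 → G y - G x ≤ (K * A) ^ (1 / μ) * (y - x) ^ (d / μ) := by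
    intro x y hxy hxy1
    have hyx : 0 ≤ y - x := sub_nonneg.2 hxy
    rcases (G.monotone hxy).eq_or_lt with heq | hlt
    · rw [heq, sub_self]
      positivity
    have ht1 : G y - G x ≤ 1 := by
      have := G.monotone (show y ≤ x + 1 by linarith)
      rw [G.map_add_one] at this
      linarith
    have ht0 : 0 < G y - G x := sub_pos.2 hlt
    -- The shift by `N * α` makes the gap that is found have index `N + j`, where the lower bound on
    -- lengths applies.
    obtain ⟨j, hj, m, hm⟩ := hK (G x - N * α) (G y - N * α) (by linarith) (by linarith)
    rw [show G y - N * α - (G x - N * α) = G y - G x by ring] at hj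
    have hlen : denjoyGapLength α h (N + j) ≤ y - x := by
      refine denjoyGapLength_le_of_forall_mem_Icc (m := m) hG hxy fun w hw => ?_
      push_cast at hw
      have h1 : G x < G w := by rw [hw]; linarith [hm.1]
      have h2 : G w < G y := by rw [hw]; linarith [hm.2]
      exact ⟨(G.monotone.reflect_lt h1).le, (G.monotone.reflect_lt h2).le⟩
    obtain ⟨hpos, hlow⟩ := hA j
    have hlow' : 1 ≤ A * ((j : ℝ) + 1) * (y - x) ^ d :=
      hlow.trans (by gcongr)
    have htμ : (G y - G x) ^ μ ≤ K * A * (y - x) ^ d := by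
      have h0 : 0 ≤ (G y - G x) ^ μ := by positivity
      calc (G y - G x) ^ μ ≤ (A * ((j : ℝ) + 1) * (y - x) ^ d) * (G y - G x) ^ μ :=
            le_mul_of_one_le_left h0 hlow'
        _ = (((j : ℝ) + 1) * (G y - G x) ^ μ) * (A * (y - x) ^ d) := by ring
        _ ≤ K * (A * (y - x) ^ d) := by gcongr
        _ = _ := by ring
    have h2 := Real.rpow_le_rpow (by positivity) htμ (show 0 ≤ 1 / μ by positivity)
    rw [← Real.rpow_mul ht0.le, mul_one_div_cancel hμ0.ne', Real.rpow_one,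
      Real.mul_rpow (by positivity) (by positivity), ← Real.rpow_mul hyx, mul_one_div] at h2
    exact h2
  have hC : 0 ≤ (K * A) ^ (1 / μ) := by positivity
  have hr : 0 ≤ d / μ := by positivity
  refine ⟨((K * A) ^ (1 / μ)).toNNReal, fun s X _ Y _ => ?_⟩
  obtain ⟨x, y, rfl, rfl, hxy⟩ := UnitAddCircle.exists_lift_dist X Y
  have hxy1 : |x - y| ≤ 1 := by
    rw [hxy, dist_eq_norm]
    refine (AddCircle.norm_le_half_period 1 one_ne_zero).trans ?_
    norm_num
  have hGxy : |G x - G y| ≤ (K * A) ^ (1 / μ) * |x - y| ^ (d / μ) := by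
    rcases le_total x y with hle | hle
    · rw [abs_sub_comm, abs_sub_comm x y, abs_of_nonneg (sub_nonneg.2 hle),
        abs_of_nonneg (sub_nonneg.2 (G.monotone hle))]
      rw [abs_sub_comm, abs_of_nonneg (sub_nonneg.2 hle)] at hxy1
      exact key x y hle hxy1
    · rw [abs_of_nonneg (sub_nonneg.2 hle), abs_of_nonneg (sub_nonneg.2 (G.monotone hle))]
      rw [abs_of_nonneg (sub_nonneg.2 hle)] at hxy1
      exact key y x hle hxy1
  have hdist : dist (h x) (h y) ≤ (K * A) ^ (1 / μ) * dist (x : UnitAddCircle) y ^ (d / μ) := by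
    rw [hG, hG, dist_eq_norm, ← AddCircle.coe_sub, ← hxy]
    exact (UnitAddCircle.norm_coe_le _).trans hGxy
  rw [edist_dist, edist_dist, Real.coe_toNNReal _ hr,
    ENNReal.ofReal_rpow_of_nonneg dist_nonneg hr]
  exact (ENNReal.ofReal_le_ofReal hdist).trans (ENNReal.ofReal_mul hC).le

/-- A point off the orbit of `0` has a preimage, which can lie in no gap; the orbit is countable, so
it has dimension 0. -/
theorem one_le_dimH_image_denjoyMinimalSet (hGc : Continuous G)
    (hG : ∀ x : ℝ, h x = ((G x : ℝ) : UnitAddCircle)) :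
    1 ≤ dimH (h '' denjoyMinimalSet α h) := by
  set O : Set UnitAddCircle := range fun n : ℤ => (((n : ℝ) * α : ℝ) : UnitAddCircle) with hO
  have hcover : univ ⊆ h '' denjoyMinimalSet α h ∪ O := by
    intro t _
    by_cases ht : t ∈ O
    · exact Or.inr ht
    left
    induction t using QuotientAddGroup.induction_on with
    | H t =>
    obtain ⟨w, hw⟩ := G.surjective_of_continuous hGc t
    have hht : h w = (t : UnitAddCircle) := by rw [hG, hw]
    refine ⟨w, fun hmem => ht ?_, hht⟩
    obtain ⟨n, hn⟩ := mem_iUnion.1 hmem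
    have : h w = (((n : ℝ) * α : ℝ) : UnitAddCircle) := denjoyGap_subset_preimage hn
    exact ⟨n, this.symm.trans hht⟩
  have h1 := UnitAddCircle.one_le_dimH_univ.trans (dimH_mono hcover)
  rwa [dimH_union, dimH_countable (countable_range _), max_eq_left zero_le] at h1

theorem le_dimH_denjoyMinimalSet {δ : ℝ} (hδ0 : 0 < δ) (hδ1 : δ < 1) (hα : Irrational α)
    (hν : IsDiophantineClass α 1) (hGc : Continuous G)
    (hG : ∀ x : ℝ, h x = ((G x : ℝ) : UnitAddCircle))
    (hJ : IsDenjoySequence δ (denjoyGapLength α h)) :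
    ENNReal.ofReal δ ≤ dimH (denjoyMinimalSet α h) := by
  refine le_of_forall_lt fun c hc => ?_
  lift c to NNReal using hc.ne_top
  have hcδ : (c : ℝ) < δ := by
    rwa [← ENNReal.ofReal_coe_nnreal, ENNReal.ofReal_lt_ofReal_iff hδ0] at hc
  obtain ⟨r, hcr, hrδ⟩ := exists_between hcδ
  obtain ⟨d, hrd, hd⟩ := exists_between hrδ
  have hr0 : 0 < r := c.2.trans_lt hcr
  have hd0 : 0 < d := hr0.trans hrd
  -- With `μ = d / r` the Hölder exponent `d / μ` is `r`.
  obtain ⟨C, hC⟩ := exists_holderOnWith_of_isDenjoySequence hα hν hG hJ hd0 hd (by linarith)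
    (show 1 < d / r by rwa [one_lt_div hr0])
  rw [div_div_cancel₀ hd0.ne'] at hC
  have h1 := (one_le_dimH_image_denjoyMinimalSet (α := α) hGc hG).trans
    ((hC (denjoyMinimalSet α h)).dimH_image_le (Real.toNNReal_pos.2 hr0))
  rw [ENNReal.le_div_iff_mul_le (Or.inl (by simpa using hr0)) (Or.inl ENNReal.coe_ne_top),
    one_mul] at h1
  refine lt_of_lt_of_le ?_ h1
  rw [ENNReal.coe_lt_coe]
  exact Real.lt_toNNReal_iff_coe_lt.2 hcr

/-! ### The upper bound -/

/-- The complement in `[a, b]` of `n` intervals, listed in increasing order by `c`, is covered by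
`n + 1` intervals of complementary total length. -/
theorem exists_cover_Icc_diff_Ioo {ι : Type*} [DecidableEq ι] (c u v : ι → ℝ) (s : Finset ι) :
    InjOn c s → (∀ i ∈ s, u i ≤ v i) → (∀ i ∈ s, ∀ j ∈ s, c i < c j → v i ≤ u j) →
    ∀ a b : ℝ, a ≤ b → (∀ i ∈ s, a ≤ u i) → (∀ i ∈ s, v i ≤ b) →
    ∃ p q : Fin (s.card + 1) → ℝ, (∀ i, p i ≤ q i) ∧
      ∑ i, (q i - p i) = b - a - ∑ i ∈ s, (v i - u i) ∧
      Icc a b \ ⋃ i ∈ s, Ioo (u i) (v i) ⊆ ⋃ i, Icc (p i) (q i) := by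
  induction s using Finset.induction_on_max_value c with
  | empty =>
    intro _ _ _ a b hab _ _
    refine ⟨fun _ => a, fun _ => b, fun _ => hab, by rw [Finset.card_empty]; simp, ?_⟩
    rintro x ⟨hx, -⟩
    exact mem_iUnion.2 ⟨0, hx⟩
  | insert x s hxs hmax ih =>
    intro hinj huv hord a b hab ha hb
    have hlt : ∀ i ∈ s, c i < c x := fun i hi =>
      (hmax i hi).lt_of_ne fun h => hxs (by
        rwa [← hinj (by simp [hi]) (by simp) h])
    -- `x` indexes the rightmost interval: the induction hypothesis covers `[a, u x]`, and `[v x,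
    -- b]` is the one new piece.
    obtain ⟨p, q, hpq, hsum, hcov⟩ := ih (hinj.mono (by simp))
      (fun i hi => huv i (Finset.mem_insert_of_mem hi))
      (fun i hi j hj => hord i (Finset.mem_insert_of_mem hi) j (Finset.mem_insert_of_mem hj))
      a (u x) (ha x (Finset.mem_insert_self x s))
      (fun i hi => ha i (Finset.mem_insert_of_mem hi))
      (fun i hi => hord i (Finset.mem_insert_of_mem hi) x (Finset.mem_insert_self x s) (hlt i hi))
    rw [Finset.card_insert_of_notMem hxs, Finset.sum_insert hxs]
    refine ⟨Fin.snoc p (v x), Fin.snoc q b, ?_, ?_, ?_⟩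
    · intro i
      refine Fin.lastCases ?_ (fun i => ?_) i
      · simpa using hb x (Finset.mem_insert_self x s)
      · simpa using hpq i
    · rw [Fin.sum_univ_castSucc]
      simp only [Fin.snoc_castSucc, Fin.snoc_last, hsum]
      ring
    · rintro y ⟨hy, hyU⟩
      simp only [mem_iUnion, not_exists] at hyU
      rcases le_or_gt y (u x) with hyu | hyu
      · obtain ⟨i, hi⟩ := mem_iUnion.1 (hcov ⟨⟨hy.1, hyu⟩, by
          simp only [mem_iUnion, not_exists]
          exact fun i hi => hyU i (Finset.mem_insert_of_mem hi)⟩)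
        exact mem_iUnion.2 ⟨i.castSucc, by simpa using hi⟩
      · have hvy : v x ≤ y := by
          by_contra! hyv
          exact hyU x (Finset.mem_insert_self x s) ⟨hyu, hyv⟩
        exact mem_iUnion.2 ⟨Fin.last _, by simpa using ⟨hvy, hy.2⟩⟩

theorem exists_cover_denjoyMinimalSet (hα : Irrational α) (hGc : Continuous G)
    (hG : ∀ x : ℝ, h x = ((G x : ℝ) : UnitAddCircle)) (s : Finset ℤ) :
    ∃ p q : Fin (s.card + 1) → ℝ, (∀ i, p i ≤ q i) ∧
      ∑ i, (q i - p i) ≤ 1 - ∑ k ∈ s, denjoyGapLength α h k ∧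
      denjoyMinimalSet α h ⊆ ⋃ i, ((↑) : ℝ → UnitAddCircle) '' Icc (p i) (q i) := by
  -- Cutting the circle over a point off the orbit leaves each gap whole inside one period `[x₀, x₀
  -- + 1]`.
  obtain ⟨t₀, ht₀⟩ := ((countable_range fun k : ℤ × ℤ => (k.1 : ℝ) * α + k.2).dense_compl
    ℝ).nonempty
  obtain ⟨x₀, hx₀⟩ := G.surjective_of_continuous hGc t₀
  have hm : ∀ k : ℤ, ∃ m : ℤ, (k : ℝ) * α + m ∈ Ioo t₀ (t₀ + 1) := by
    intro k
    refine ⟨-⌊(k : ℝ) * α - t₀⌋, lt_of_le_of_ne ?_ fun h => ht₀ ⟨⟨k, _⟩, h.symm⟩, ?_⟩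
    · push_cast
      linarith [Int.floor_le ((k : ℝ) * α - t₀)]
    · push_cast
      linarith [Int.lt_floor_add_one ((k : ℝ) * α - t₀)]
  choose m hm using hm
  choose u v huv hlevel using fun k : ℤ => G.exists_eq_iff_mem_Icc hGc ((k : ℝ) * α + m k)
  have hu : ∀ k, G (u k) = k * α + m k := fun k => (hlevel k _).2 (left_mem_Icc.2 (huv k))
  have hv : ∀ k, G (v k) = k * α + m k := fun k => (hlevel k _).2 (right_mem_Icc.2 (huv k))
  have hinj : Function.Injective fun k : ℤ => (k : ℝ) * α + m k := by
    intro i j hij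
    by_contra hne
    refine (hα.intCast_mul (sub_ne_zero.2 hne)).ne_int (m j - m i) ?_
    push_cast
    linarith [show (i : ℝ) * α + m i = j * α + m j from hij]
  obtain ⟨p, q, hpq, hsum, hcov⟩ := exists_cover_Icc_diff_Ioo
    (fun k : ℤ => (k : ℝ) * α + m k) u v s hinj.injOn (fun i _ => huv i)
    (fun i _ j _ hij => (G.monotone.reflect_lt (by rw [hv, hu]; exact hij)).le)
    x₀ (x₀ + 1) (by linarith)
    (fun i _ => (G.monotone.reflect_lt (by rw [hx₀, hu]; exact (hm i).1)).le)
    (fun i _ => (G.monotone.reflect_lt (by rw [G.map_add_one, hx₀, hv]; exact (hm i).2)).le)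
  refine ⟨p, q, hpq, ?_, ?_⟩
  · rw [hsum, add_sub_cancel_left]
    refine sub_le_sub_left (Finset.sum_le_sum fun k _ => ?_) 1
    exact denjoyGapLength_le_of_forall_mem_Icc hG (huv k) fun w hw => (hlevel k w).1 hw
  · intro z hz
    induction z using QuotientAddGroup.induction_on with
    | H x =>
    have hcoe : ((x - ⌊x - x₀⌋ : ℝ) : UnitAddCircle) = x :=
      UnitAddCircle.coe_eq_coe_iff.2 ⟨⌊x - x₀⌋, by ring⟩
    have hmem : x - ⌊x - x₀⌋ ∈ Icc x₀ (x₀ + 1) \ ⋃ k ∈ s, Ioo (u k) (v k) := by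
      refine ⟨⟨by linarith [Int.floor_le (x - x₀)], by linarith [Int.lt_floor_add_one (x - x₀)]⟩,
        fun hgap => hz ?_⟩
      simp only [mem_iUnion] at hgap
      obtain ⟨k, -, hk⟩ := hgap
      refine mem_iUnion.2 ⟨k, image_coe_Ioo_subset_denjoyGap hG (m := m k) ?_ ⟨_, hk, hcoe⟩⟩
      exact fun w hw => (hlevel k w).2 (Ioo_subset_Icc_self hw)
    obtain ⟨i, hi⟩ := mem_iUnion.1 (hcov hmem)
    exact mem_iUnion.2 ⟨i, _, hi, hcoe⟩

/-- Power mean inequality with exponent `1 / d ≥ 1`, applied to the numbers `f i ^ d`. -/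
theorem sum_rpow_le_card_rpow_mul {ι : Type*} (s : Finset ι) (f : ι → ℝ) {d : ℝ}
    (hd0 : 0 < d) (hd1 : d ≤ 1) (hf : ∀ i ∈ s, 0 ≤ f i) :
    ∑ i ∈ s, f i ^ d ≤ (s.card : ℝ) ^ (1 - d) * (∑ i ∈ s, f i) ^ d := by
  have h1 := Real.rpow_sum_le_const_mul_sum_rpow s (fun i => f i ^ d)
    (show 1 ≤ 1 / d by rwa [one_le_div hd0])
  have h2 : ∀ i ∈ s, |f i ^ d| = f i ^ d := fun i hi => abs_of_nonneg (Real.rpow_nonneg (hf i hi) _)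
  have hinv : ∀ i ∈ s, |f i ^ d| ^ (1 / d) = f i := fun i hi => by
    rw [h2 i hi, ← Real.rpow_mul (hf i hi), mul_one_div_cancel hd0.ne', Real.rpow_one]
  rw [Finset.sum_congr rfl h2, Finset.sum_congr rfl hinv] at h1
  have h3 : 0 ≤ ∑ i ∈ s, f i ^ d := Finset.sum_nonneg fun i hi => Real.rpow_nonneg (hf i hi) _
  have h4 := Real.rpow_le_rpow (by positivity) h1 hd0.le
  rw [← Real.rpow_mul h3, one_div_mul_cancel hd0.ne', Real.rpow_one,
    Real.mul_rpow (by positivity) (Finset.sum_nonneg hf), ← Real.rpow_mul (by positivity)] at h4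
  rwa [show (1 / d - 1) * d = 1 - d by field_simp] at h4

theorem tsum_natAbs_gt_eq {l : ℤ → ℝ} (hl : HasSum l 1) (n : ℕ) :
    ∑' k : {k : ℤ // (n : ℤ) < |k|}, l k = 1 - ∑ k ∈ Finset.Icc (-n : ℤ) n, l k := by
  have h1 := hl.summable.sum_add_tsum_subtype_compl (Finset.Icc (-n : ℤ) n)
  rw [hl.tsum_eq] at h1
  rw [← h1, add_sub_cancel_left]
  have h2 : ∀ k : ℤ, (n : ℤ) < |k| ↔ k ∉ Finset.Icc (-n : ℤ) n := by
    intro k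
    rw [Finset.mem_Icc, ← abs_le, not_le]
  exact (Equiv.subtypeEquivRight h2).tsum_eq fun k : {k : ℤ // k ∉ Finset.Icc (-n : ℤ) n} => l k

theorem dimH_denjoyMinimalSet_le_of_tail {d C : ℝ} (hd0 : 0 < d) (hd1 : d < 1) (hα : Irrational α)
    (hGc : Continuous G) (hG : ∀ x : ℝ, h x = ((G x : ℝ) : UnitAddCircle))
    (hJ : HasSum (denjoyGapLength α h) 1) {n : ℕ → ℕ} (hn : StrictMono n)
    (htail : ∀ s : ℕ, 0 < n s ∧ ∑' k : {k : ℤ // (n s : ℤ) < |k|}, denjoyGapLength α h k ≤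
      C * (n s : ℝ) ^ (1 - 1 / d)) :
    dimH (denjoyMinimalSet α h) ≤ ENNReal.ofReal d := by
  choose p q hpq hsum hcov using fun s : ℕ =>
    exists_cover_denjoyMinimalSet hα hGc hG (Finset.Icc (-(n s) : ℤ) (n s))
  set B : ℝ := max C 0 with hB
  have hB0 : 0 ≤ B := le_max_right _ _
  have hexp : 1 - 1 / d < 0 := by rw [sub_neg, one_lt_div hd0]; exact hd1
  have hsumB : ∀ s, ∑ i, (q s i - p s i) ≤ B * (n s : ℝ) ^ (1 - 1 / d) := by
    intro s
    refine (hsum s).trans ?_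
    rw [← tsum_natAbs_gt_eq hJ]
    exact (htail s).2.trans (by gcongr; exact le_max_left _ _)
  have hnonneg : ∀ s i, 0 ≤ q s i - p s i := fun s i => sub_nonneg.2 (hpq s i)
  have hdiam : ∀ s i, Metric.ediam (((↑) : ℝ → UnitAddCircle) '' Icc (p s i) (q s i)) ≤
      ENNReal.ofReal (q s i - p s i) := by
    intro s i
    have := UnitAddCircle.lipschitzWith_coe.ediam_image_le (Icc (p s i) (q s i))
    rwa [ENNReal.coe_one, one_mul, Real.ediam_Icc] at this
  have hr : Tendsto (fun s => ENNReal.ofReal (B * (n s : ℝ) ^ (1 - 1 / d))) atTop (nhds 0) := by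
    rw [← ENNReal.ofReal_zero]
    refine ENNReal.tendsto_ofReal ?_
    rw [← mul_zero B]
    refine Tendsto.const_mul B ?_
    have h1 := tendsto_rpow_neg_atTop (show 0 < -(1 - 1 / d) by linarith)
    rw [neg_neg] at h1
    exact h1.comp (tendsto_natCast_atTop_atTop.comp hn.tendsto_atTop)
  have hbound : ∀ s, ∑ i, Metric.ediam (((↑) : ℝ → UnitAddCircle) '' Icc (p s i) (q s i)) ^ d ≤
      ENNReal.ofReal (4 ^ (1 - d) * B ^ d) := by
    intro s
    have hn1 : (1 : ℝ) ≤ n s := by exact_mod_cast (htail s).1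
    have hn0 : (0 : ℝ) ≤ n s := Nat.cast_nonneg _
    -- `2n + 1` gaps leave `2n + 2` arcs, at most `4n` since `n ≥ 1`.
    have hcard : ((Finset.Icc (-(n s) : ℤ) (n s)).card + 1 : ℝ) ≤ 4 * n s := by
      have : (Finset.Icc (-(n s) : ℤ) (n s)).card = 2 * n s + 1 := by
        rw [Int.card_Icc]; omega
      rw [this]
      push_cast
      linarith
    calc ∑ i, Metric.ediam (((↑) : ℝ → UnitAddCircle) '' Icc (p s i) (q s i)) ^ d
        ≤ ∑ i, ENNReal.ofReal ((q s i - p s i) ^ d) := by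
          refine Finset.sum_le_sum fun i _ => ?_
          rw [← ENNReal.ofReal_rpow_of_nonneg (hnonneg s i) hd0.le]
          exact ENNReal.rpow_le_rpow (hdiam s i) hd0.le
      _ = ENNReal.ofReal (∑ i, (q s i - p s i) ^ d) :=
          (ENNReal.ofReal_sum_of_nonneg fun i _ => Real.rpow_nonneg (hnonneg s i) d).symm
      _ ≤ ENNReal.ofReal (4 ^ (1 - d) * B ^ d) := by
          refine ENNReal.ofReal_le_ofReal ?_
          refine (sum_rpow_le_card_rpow_mul _ _ hd0 hd1.le fun i _ => hnonneg s i).trans ?_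
          rw [Finset.card_univ, Fintype.card_fin, Nat.cast_add, Nat.cast_one]
          calc (((Finset.Icc (-(n s) : ℤ) (n s)).card : ℝ) + 1) ^ (1 - d) *
                (∑ i, (q s i - p s i)) ^ d
              ≤ (4 * (n s : ℝ)) ^ (1 - d) * (B * (n s : ℝ) ^ (1 - 1 / d)) ^ d := by
                have h1 : 0 ≤ 1 - d := by linarith
                have h2 : 0 ≤ ∑ i, (q s i - p s i) := Finset.sum_nonneg fun i _ => hnonneg s i
                have h3 := hsumB s
                gcongr
            _ = 4 ^ (1 - d) * B ^ d * ((n s : ℝ) ^ (1 - d) * (n s : ℝ) ^ ((1 - 1 / d) * d)) := by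
                rw [Real.mul_rpow (by norm_num) hn0, Real.mul_rpow hB0 (by positivity),
                  ← Real.rpow_mul hn0]
                ring
            _ = 4 ^ (1 - d) * B ^ d := by
                rw [← Real.rpow_add (by linarith),
                  show 1 - d + (1 - 1 / d) * d = 0 by field_simp; ring, Real.rpow_zero, mul_one]
  -- Each diameter is at most the total length, so the mesh of the covers tends to 0.
  have hmeas := Measure.hausdorffMeasure_le_liminf_sum d (denjoyMinimalSet α h)
    (fun s => ENNReal.ofReal (B * (n s : ℝ) ^ (1 - 1 / d))) hr
    (fun s i => ((↑) : ℝ → UnitAddCircle) '' Icc (p s i) (q s i))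
    (Eventually.of_forall fun s i => (hdiam s i).trans (ENNReal.ofReal_le_ofReal
      ((Finset.single_le_sum (fun i _ => hnonneg s i) (Finset.mem_univ i)).trans (hsumB s))))
    (Eventually.of_forall hcov)
  have hfin := hmeas.trans ((liminf_le_liminf (Eventually.of_forall hbound)).trans_eq
    (liminf_const _))
  refine dimH_le_of_hausdorffMeasure_ne_top (d := d.toNNReal) ?_
  rw [Real.coe_toNNReal d hd0.le]
  exact (hfin.trans_lt ENNReal.ofReal_lt_top).ne

end Lift

theorem mainTheorem5 (δ α : ℝ) (hδ0 : 0 < δ) (hδ1 : δ < 1)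
    (hα0 : 0 < α) (hα1 : α < 1) (hα : Irrational α) (hν : IsDiophantineClass α 1)
    (f : UnitAddCircle ≃ₜ UnitAddCircle) (hf : IsMonotoneDegreeOne f)
    (h : UnitAddCircle → UnitAddCircle) (hh : IsRotationSemiconj α f h)
    (hJ : IsDenjoySequence δ (denjoyGapLength α h))
    (htail : ∀ ε : ℝ, 0 < ε → ∃ (n : ℕ → ℕ) (C : ℝ), StrictMono n ∧ ∀ s : ℕ, 0 < n s ∧
      ∑' k : {k : ℤ // (n s : ℤ) < |k|}, denjoyGapLength α h k ≤
        C * (n s : ℝ) ^ (1 - 1 / (δ + ε))) :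
    dimH (denjoyMinimalSet α h) = ENNReal.ofReal δ := by
  obtain ⟨G, hGc, hG⟩ := hh.monotone_degree_one
  refine le_antisymm (le_of_forall_gt fun c hc => ?_)
    (le_dimH_denjoyMinimalSet hδ0 hδ1 hα hν hGc hG hJ)
  obtain ⟨e, he, hec⟩ := exists_between hc
  lift e to NNReal using hec.ne_top
  have hδe : δ < e := by
    rwa [← ENNReal.ofReal_coe_nnreal, ENNReal.ofReal_lt_ofReal_iff_of_nonneg hδ0.le] at he
  -- `d < 1` makes the tail exponent `1 - 1 / d` negative; `ε = d - δ` turns `δ + ε` into `d`.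
  obtain ⟨d, hδd, hd⟩ := exists_between (lt_min hδe hδ1)
  obtain ⟨n, C, hn, htl⟩ := htail (d - δ) (sub_pos.2 hδd)
  rw [add_sub_cancel] at htl
  refine (dimH_denjoyMinimalSet_le_of_tail (hδ0.trans hδd) (hd.trans_le (min_le_right _ _)) hα hGc
    hG hJ.hasSum hn htl).trans_lt (lt_of_le_of_lt ?_ hec)
  rw [← ENNReal.ofReal_coe_nnreal]
  exact ENNReal.ofReal_le_ofReal (hd.le.trans (min_le_left _ _))
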